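/- For a finite group $H$ let $F(H)$ be its Fitting subgroup (the largest nilpotent normal subgroup). Put $\nu_0(H)=F(H)$ and let $\nu_{i+1}(H)$ be the smallest subgroup of $\nu_i(H)$ that is normal in $F(H)$ and such that $\nu_i(H)/\nu_{i+1}(H)$ is a direct product of elementary abelian groups and is centralized by $F(H)$. The $F$-class of $H$ is the least $c$ with $\nu_c(H)=1$, and the $F$-rank of $H$ is $|\nu_0(H)/\nu_1(H)|$. Let $G$ be a finite group of $F$-class $c$, and let $k$ be the product of the distinct primes dividing the $F$-rank of $G$. Let $g_1,\dots,g_n$ be any generators of $G$, let $F$ be the free group on $f_1,\dots,f_n$, and let $\mu:F\to G$ be the homomorphism with $\mu(f_i)=g_i$. Let $R=\ker\mu$, let $L=\mu^{-1}(F(G))$, and let $K=[R,L]R^k$, where $R^k$ is the subgroup generated by the $k$-th powers of elements of $R$. Let $G^*=F/K$ be the corresponding covering group of $G$, with multiplicator $M=R/K$ and nucleus $N=\nu_c(G^*)$. A subgroup $U$ of $G^*$ is called allowable if $U$ is a proper subgroup of $M$, $U$ is normal in $G^*$, and $NU=M$. Let $\mathrm{Aut}_M(G^*)$ be the group of all automorphisms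 $\alpha$ of $G^*$ with $\alpha(M)=M$. Let $U_1,U_2$ be allowable subgroups of $G^*$. Then $G^*/U_1\cong G^*/U_2$ if and only if there exists $\alpha\in\mathrm{Aut}_M(G^*)$ with $\alpha(U_1)=U_2$. -/

import Mathlib

namespace FCentral

/-- The Fitting subgroup: the join of all nilpotent normal subgroups. For a finite group this
is the largest nilpotent normal subgroup. -/
def fitting (G : Type*) [Group G] : Subgroup G :=
  sSup {H : Subgroup G | H.Normal ∧ Group.IsNilpotent H}

/-- A (finite) direct product of elementary abelian groups. Every elementary abelian `p`-group is
a direct product of cyclic groups of order `p`, so such a group is a direct product of cyclic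
groups of prime order, the primes not necessarily being distinct. -/
def IsProdElementaryAbelian (Q : Type*) [Group Q] : Prop :=
  ∃ (ι : Type) (_ : Finite ι) (p : ι → ℕ),
    (∀ i, (p i).Prime) ∧ Nonempty (Q ≃* ((i : ι) → Multiplicative (ZMod (p i))))

/-- `S` is a subgroup of `H`, normal in the Fitting subgroup `F`, such that `H / S` is
a direct product of elementary abelian groups and is centralized by `F`. -/
def IsFCentralStep {G : Type*} [Group G] (H S : Subgroup G) : Prop :=
  S ≤ H ∧ (S.subgroupOf (fitting G)).Normal ∧
    (∃ _ : (S.subgroupOf H).Normal, IsProdElementaryAbelian (H ⧸ S.subgroupOf H)) ∧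
    ⁅fitting G, H⁆ ≤ S

/-- The terms `ν_i(G)` of the `F`-central series: `ν_0(G)` is the Fitting subgroup and
`ν_{i+1}(G)` is the smallest `S` with `IsFCentralStep (ν_i(G)) S`. -/
def nu (G : Type*) [Group G] : ℕ → Subgroup G
  | 0 => fitting G
  | i + 1 => sInf {S : Subgroup G | IsFCentralStep (nu G i) S}

/-- The `F`-class: the smallest `c` with `ν_c(G) = 1`. -/
noncomputable def fClass (G : Type*) [Group G] : ℕ :=
  sInf {c : ℕ | nu G c = ⊥}

/-- The `F`-rank: the order of `ν_0(G) / ν_1(G)`. -/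
noncomputable def fRank (G : Type*) [Group G] : ℕ :=
  (nu G 1).relIndex (nu G 0)

/-- `H^k`: the subgroup generated by the `k`-th powers of the elements of `H`. -/
def powerSubgroup {G : Type*} [Group G] (H : Subgroup G) (k : ℕ) : Subgroup G :=
  Subgroup.closure ((fun x => x ^ k) '' (H : Set G))

theorem fitting_normal (G : Type*) [Group G] : (fitting G).Normal := by
  exact Subgroup.sSup_normal _ fun _ hH => hH.1

theorem powerSubgroup_normal {G : Type*} [Group G] (H : Subgroup G) (hH : H.Normal) (k : ℕ) :
    (powerSubgroup H k).Normal := by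
  refine ⟨fun x hx g => ?_⟩
  suffices h : powerSubgroup H k ≤ (powerSubgroup H k).comap (MulAut.conj g).toMonoidHom from h hx
  refine (Subgroup.closure_le _).2 ?_
  rintro _ ⟨y, hy, rfl⟩
  refine Subgroup.subset_closure ⟨g * y * g⁻¹, hH.conj_mem y hy g, ?_⟩
  simp [conj_pow]

section Covering

variable {G : Type*} [Group G] {n : ℕ}

/-- The presentation homomorphism `μ : F → G`, `f_i ↦ g_i`, on the free group of rank `n`. -/
def presentation (g : Fin n → G) : FreeGroup (Fin n) →* G :=
  FreeGroup.lift g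

/-- `K = [R, L] R^k`, where `R = ker μ`, `L` is the full preimage of the Fitting subgroup
and `k` is the product of the distinct primes dividing the `F`-rank of `G`. -/
noncomputable def coveringKernel (g : Fin n → G) : Subgroup (FreeGroup (Fin n)) :=
  ⁅(presentation g).ker, (fitting G).comap (presentation g)⁆ ⊔
    powerSubgroup (presentation g).ker (UniqueFactorizationMonoid.radical (fRank G))

instance coveringKernel_normal (g : Fin n → G) : (coveringKernel g).Normal := by
  have h₁ : ((fitting G).comap (presentation g)).Normal := (fitting_normal G).comap _
  have h₂ := powerSubgroup_normal (presentation g).ker inferInstance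
    (UniqueFactorizationMonoid.radical (fRank G))
  unfold coveringKernel
  infer_instance

/-- The covering group `G* = F / K` belonging to the generating tuple `g`. -/
abbrev CoveringGroup (g : Fin n → G) : Type :=
  FreeGroup (Fin n) ⧸ coveringKernel g

/-- The multiplicator `M = R / K`. -/
noncomputable def multiplicator (g : Fin n → G) : Subgroup (CoveringGroup g) :=
  (presentation g).ker.map (QuotientGroup.mk' (coveringKernel g))

/-- The nucleus `N = ν_c(G*)`, where `c` is the `F`-class of `G`. -/
noncomputable def nucleus (g : Fin n → G) : Subgroup (CoveringGroup g) :=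
  nu (CoveringGroup g) (fClass G)

/-- Allowable subgroups: proper subgroups `U` of `M`, normal in `G*`, with `N U = M`. -/
structure IsAllowable (g : Fin n → G) (U : Subgroup (CoveringGroup g)) : Prop where
  normal : U.Normal
  lt_multiplicator : U < multiplicator g
  nucleus_sup : nucleus g ⊔ U = multiplicator g

/-- `Aut_M(G*)`: the group of automorphisms of `G*` that leave `M` setwise invariant. -/
def autM (g : Fin n → G) : Subgroup (MulAut (CoveringGroup g)) where
  carrier := {α | (multiplicator g).map α.toMonoidHom = multiplicator g}
  one_mem' := Subgroup.map_id _
  mul_mem' {α β} hα hβ := by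
    have h : (α * β).toMonoidHom = α.toMonoidHom.comp β.toMonoidHom := rfl
    change (multiplicator g).map (α * β).toMonoidHom = multiplicator g
    rw [h, ← Subgroup.map_map, hβ, hα]
  inv_mem' {α} hα := by
    have h : (α⁻¹).toMonoidHom.comp α.toMonoidHom = MonoidHom.id _ := by
      refine MonoidHom.ext fun x => ?_
      exact α.symm_apply_apply x
    change (multiplicator g).map (α⁻¹).toMonoidHom = multiplicator g
    replace hα : (multiplicator g).map α.toMonoidHom = multiplicator g := hα
    conv_lhs => rw [← hα]
    rw [Subgroup.map_map, h, Subgroup.map_id]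

end Covering

end FCentral

namespace FCentral

/-! An automorphism of `G*` carrying `U₁` to `U₂` plainly induces an isomorphism of quotients. For
the converse, the preimage of `F(G)` centralizes `M`, so Fitting subgroups, and with them the terms
`ν_i`, behave well under `G* → G*/U`. As `NU = M`, the subgroup `M/U` is `ν_c(G*/U)`, which every
isomorphism `ψ : G*/U₁ ≃* G*/U₂` respects (`map_nu`, `IsAllowable.map_mk_multiplicator`).

By Gaschütz's lemma the images under `ψ` of the standard generators lift to generators of `G*`,
giving an epimorphism `θ : F → G*`. It sends `R` into `M` and `L` into the preimage of `F(G)`, hence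
kills `K = [R, L] R^k`. The induced surjective endomorphism of `G*` is bijective because `G*` is
finite. -/

/-! ### The `F`-central series of a finite group -/

theorem IsProdElementaryAbelian.exists_squarefree_pow_eq_one {Q : Type*} [Group Q]
    (h : IsProdElementaryAbelian Q) : ∃ m : ℕ, Squarefree m ∧ ∀ x : Q, x ^ m = 1 := by
  obtain ⟨ι, hι, p, hp, ⟨e⟩⟩ := h
  have := Fintype.ofFinite ι
  refine ⟨UniqueFactorizationMonoid.radical (∏ i, p i),
    UniqueFactorizationMonoid.squarefree_radical, fun x => ?_⟩
  apply e.injective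
  rw [map_pow, map_one]
  funext i
  have hi : p i ∣ UniqueFactorizationMonoid.radical (∏ i, p i) :=
    (UniqueFactorizationMonoid.dvd_radical_iff_of_irreducible (hp i)
      (Finset.prod_ne_zero_iff.2 fun j _ => (hp j).ne_zero)).2
      (Finset.dvd_prod_of_mem p (Finset.mem_univ i))
  obtain ⟨t, ht⟩ := hi
  rw [ht, Pi.pow_apply, Pi.one_apply, pow_mul]
  have : e x i ^ p i = 1 := by
    apply Multiplicative.toAdd.injective
    simp
  rw [this, one_pow]

/-- Decompose `Q` into cyclic groups of prime power order and discard the trivial factors. Each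
remaining order divides the squarefree `m`, so it is prime. -/
theorem isProdElementaryAbelian_of_squarefree {Q : Type*} [Group Q] [Finite Q]
    (hc : ∀ x y : Q, x * y = y * x) {m : ℕ} (hm : Squarefree m) (hQ : ∀ x : Q, x ^ m = 1) :
    IsProdElementaryAbelian Q := by
  classical
  let _ : CommGroup Q := { ‹Group Q› with mul_comm := hc }
  obtain ⟨ι, hι, p, hp, n, ⟨e⟩⟩ := AddCommGroup.equiv_directSum_zmod_of_finite (Additive Q)
  let q : {i : ι // n i ≠ 0} → ℕ := fun i => p i ^ n i
  let e₀ : Q ≃* ((i : ι) → Multiplicative (ZMod (p i ^ n i))) :=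
    MulEquiv.toAdditive.symm <| e.trans <|
      (DirectSum.addEquivProd _).trans (MulEquiv.piMultiplicative _).toAdditiveRight
  let r : ((i : ι) → Multiplicative (ZMod (p i ^ n i))) →*
      ((i : {i : ι // n i ≠ 0}) → Multiplicative (ZMod (q i))) :=
    MonoidHom.pi fun i => Pi.evalMonoidHom _ i.1
  have hr : Function.Bijective r := by
    refine ⟨fun x y hxy => funext fun i => ?_, fun y => ?_⟩
    · by_cases hi : n i = 0
      · have : Subsingleton (ZMod (p i ^ n i)) := ZMod.subsingleton_iff.2 (by rw [hi, pow_zero])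
        exact Multiplicative.toAdd.injective (Subsingleton.elim _ _)
      · exact congrFun hxy ⟨i, hi⟩
    · refine ⟨fun i => if hi : n i = 0 then 1 else y ⟨i, hi⟩, funext fun i => ?_⟩
      exact dif_neg i.2
  let e' := e₀.trans (MulEquiv.ofBijective r hr)
  refine ⟨_, inferInstance, q, fun i => ?_, ⟨e'⟩⟩
  -- The exponent condition is tested on a generator of the `i`-th factor.
  have hd : q i ∣ m := by
    have h := congrFun (congrArg e'
      (hQ (e'.symm (Pi.mulSingle i (Multiplicative.ofAdd (1 : ZMod (q i))))))) i
    rw [map_pow, e'.apply_symm_apply, map_one e', Pi.pow_apply, Pi.mulSingle_eq_same,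
      Pi.one_apply] at h
    have h' : m • (1 : ZMod (q i)) = 0 := congrArg Multiplicative.toAdd h
    rwa [nsmul_one, ZMod.natCast_eq_zero_iff] at h'
  have hsq := hm.squarefree_of_dvd hd
  rcases (Nat.squarefree_pow_iff (hp i).ne_one i.2).1 hsq with ⟨-, h1⟩
  simpa [q, h1] using hp i

theorem exists_squarefree_dvd_of_squarefree {a b : ℕ} (ha : Squarefree a) (hb : Squarefree b) :
    ∃ m, Squarefree m ∧ a ∣ m ∧ b ∣ m := by
  have hab : a * b ≠ 0 := mul_ne_zero ha.ne_zero hb.ne_zero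
  exact ⟨UniqueFactorizationMonoid.radical (a * b), UniqueFactorizationMonoid.squarefree_radical,
    (UniqueFactorizationMonoid.dvd_radical_iff ha.isRadical hab).2 (dvd_mul_right _ _),
    (UniqueFactorizationMonoid.dvd_radical_iff hb.isRadical hab).2 (dvd_mul_left _ _)⟩

/-- The exponent form passes to intersections and along homomorphisms. Since `H` lies in the Fitting
subgroup, the commutator condition already yields both normality conditions and commutativity of the
quotient. -/
theorem isFCentralStep_iff {A : Type*} [Group A] [Finite A] {H S : Subgroup A}
    (hH : H ≤ fitting A) :
    IsFCentralStep H S ↔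
      S ≤ H ∧ (∃ m : ℕ, Squarefree m ∧ ∀ x ∈ H, x ^ m ∈ S) ∧ ⁅fitting A, H⁆ ≤ S := by
  constructor
  · rintro ⟨hS, -, ⟨hn, hQ⟩, hF⟩
    obtain ⟨m, hm, hx⟩ := hQ.exists_squarefree_pow_eq_one
    refine ⟨hS, ⟨m, hm, fun x hxH => ?_⟩, hF⟩
    have h := hx (QuotientGroup.mk ⟨x, hxH⟩)
    rw [← QuotientGroup.mk_pow, QuotientGroup.eq_one_iff, Subgroup.mem_subgroupOf] at h
    exact h
  · rintro ⟨hS, ⟨m, hm, hx⟩, hF⟩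
    have hconj : ∀ f ∈ fitting A, ∀ s ∈ S, f * s * f⁻¹ ∈ S := fun f hf s hs => by
      simpa [commutatorElement_def] using
        S.mul_mem (hF (Subgroup.commutator_mem_commutator hf (hS hs))) hs
    have hn : (S.subgroupOf H).Normal :=
      ⟨fun s hs f => hconj f (hH f.2) s hs⟩
    refine ⟨hS, ⟨fun s hs f => hconj f f.2 s hs⟩, ⟨hn, ?_⟩, hF⟩
    refine isProdElementaryAbelian_of_squarefree ?_ hm ?_
    · rintro ⟨x⟩ ⟨y⟩
      change ((x * y : H) : H ⧸ S.subgroupOf H) = (y * x : H)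
      rw [QuotientGroup.eq, Subgroup.mem_subgroupOf]
      have := hF (Subgroup.commutator_mem_commutator (hH (inv_mem y.2)) (inv_mem x.2))
      simpa [commutatorElement_def, mul_assoc] using this
    · rintro ⟨x⟩
      change ((x ^ m : H) : H ⧸ S.subgroupOf H) = 1
      rw [QuotientGroup.eq_one_iff, Subgroup.mem_subgroupOf]
      exact hx x x.2

/-- Two steps intersect in a step, with a common squarefree multiple as exponent, so a minimal step
is the least one. -/
theorem isFCentralStep_sInf {A : Type*} [Group A] [Finite A] {H : Subgroup A}
    (hH : H ≤ fitting A) (hF : ⁅fitting A, H⁆ ≤ H) :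
    IsFCentralStep H (sInf {S : Subgroup A | IsFCentralStep H S}) := by
  have hne : {S : Subgroup A | IsFCentralStep H S}.Nonempty :=
    ⟨H, (isFCentralStep_iff hH).2 ⟨le_rfl, ⟨1, squarefree_one, by simp⟩, hF⟩⟩
  obtain ⟨S, hS⟩ := (Set.toFinite {S : Subgroup A | IsFCentralStep H S}).exists_minimal hne
  have hle : ∀ T, IsFCentralStep H T → S ≤ T := fun T hT => by
    obtain ⟨hSH, ⟨a, ha, hSa⟩, hSF⟩ := (isFCentralStep_iff hH).1 hS.1
    obtain ⟨-, ⟨b, hb, hTb⟩, hTF⟩ := (isFCentralStep_iff hH).1 hT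
    obtain ⟨m, hm, ⟨s, rfl⟩, ⟨t, ht⟩⟩ := exists_squarefree_dvd_of_squarefree ha hb
    have hinf : IsFCentralStep H (S ⊓ T) := by
      refine (isFCentralStep_iff hH).2 ⟨inf_le_left.trans hSH, ⟨_, hm, fun x hx => ⟨?_, ?_⟩⟩,
        le_inf hSF hTF⟩
      · rw [pow_mul]
        exact pow_mem (hSa x hx) s
      · rw [ht, pow_mul]
        exact pow_mem (hTb x hx) t
    exact (hS.2 hinf inf_le_left).trans inf_le_right
  rw [le_antisymm (sInf_le hS.1) (le_sInf hle)]
  exact hS.1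

theorem nu_le_fitting_and_commutator_le (A : Type*) [Group A] [Finite A] (i : ℕ) :
    nu A i ≤ fitting A ∧ ⁅fitting A, nu A i⁆ ≤ nu A i := by
  induction i with
  | zero =>
    have := fitting_normal A
    exact ⟨le_rfl, Subgroup.commutator_le_right (fitting A) (fitting A)⟩
  | succ i ih =>
    have h := isFCentralStep_sInf ih.1 ih.2
    exact ⟨h.1.trans ih.1, (Subgroup.commutator_mono le_rfl h.1).trans h.2.2.2⟩

theorem isFCentralStep_nu_succ (A : Type*) [Group A] [Finite A] (i : ℕ) :
    IsFCentralStep (nu A i) (nu A (i + 1)) :=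
  isFCentralStep_sInf (nu_le_fitting_and_commutator_le A i).1
    (nu_le_fitting_and_commutator_le A i).2

theorem nu_succ_le {A : Type*} [Group A] {i : ℕ} {S : Subgroup A}
    (hS : IsFCentralStep (nu A i) S) : nu A (i + 1) ≤ S :=
  sInf_le (show S ∈ {S : Subgroup A | IsFCentralStep (nu A i) S} from hS)

/-- Images of steps are steps, and so are preimages cut down to `nu A i`; minimality on each side
gives the two inclusions. -/
theorem map_nu {A B : Type*} [Group A] [Finite A] [Group B] [Finite B] (f : A →* B)
    (hfit : (fitting A).map f = fitting B) (i : ℕ) : (nu A i).map f = nu B i := by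
  induction i with
  | zero => exact hfit
  | succ i ih =>
    have hA := nu_le_fitting_and_commutator_le A i
    have hB := nu_le_fitting_and_commutator_le B i
    apply le_antisymm
    · obtain ⟨hSH, ⟨m, hm, hx⟩, hF⟩ := (isFCentralStep_iff hB.1).1 (isFCentralStep_nu_succ B i)
      rw [Subgroup.map_le_iff_le_comap]
      have hstep : IsFCentralStep (nu A i) (nu A i ⊓ (nu B (i + 1)).comap f) := by
        refine (isFCentralStep_iff hA.1).2 ⟨inf_le_left,
          ⟨m, hm, fun x hxA => ⟨pow_mem hxA m, ?_⟩⟩, le_inf hA.2 ?_⟩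
        · change f (x ^ m) ∈ nu B (i + 1)
          rw [map_pow]
          exact hx _ (ih ▸ Subgroup.mem_map_of_mem f hxA)
        · rw [← Subgroup.map_le_iff_le_comap, Subgroup.map_commutator, ih, hfit]
          exact hF
      exact (nu_succ_le hstep).trans inf_le_right
    · obtain ⟨hSH, ⟨m, hm, hx⟩, hF⟩ := (isFCentralStep_iff hA.1).1 (isFCentralStep_nu_succ A i)
      refine nu_succ_le ((isFCentralStep_iff hB.1).2 ⟨?_, ⟨m, hm, fun y hy => ?_⟩, ?_⟩)
      · rw [← ih]
        exact Subgroup.map_mono hSH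
      · rw [← ih] at hy
        obtain ⟨x, hxA, rfl⟩ := hy
        rw [← map_pow]
        exact Subgroup.mem_map_of_mem f (hx x hxA)
      · rw [← hfit, ← ih, ← Subgroup.map_commutator]
        exact Subgroup.map_mono hF

/-! ### Fitting subgroups under epimorphisms -/

theorem map_fitting_le {A B : Type*} [Group A] [Group B] (f : A →* B)
    (hf : Function.Surjective f) : (fitting A).map f ≤ fitting B := by
  rw [Subgroup.map_le_iff_le_comap]
  refine sSup_le fun H hH => ?_
  rw [← Subgroup.map_le_iff_le_comap]
  have := hH.2
  exact le_sSup ⟨hH.1.map f hf,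
    Group.nilpotent_of_surjective (f.subgroupMap H) (f.subgroupMap_surjective H)⟩

/-- The preimage of a nilpotent normal subgroup is a central extension of it by `f.ker`, hence
nilpotent. -/
theorem comap_fitting_le_of_commutator_eq_bot {A B : Type*} [Group A] [Group B] (f : A →* B)
    (hf : Function.Surjective f) (hk : ⁅f.ker, (fitting B).comap f⁆ = ⊥) :
    (fitting B).comap f ≤ fitting A := by
  have hkey : ∀ H : Subgroup B, H.Normal → Group.IsNilpotent H → H.comap f ≤ fitting A := by
    intro H hn hH
    refine le_sSup ⟨hn.comap f, ?_⟩
    refine Subgroup.isNilpotent_of_ker_le_center (f.subgroupComap H) ?_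
    intro x hx
    rw [Subgroup.mem_center_iff]
    intro y
    have hy : (y : A) ∈ (fitting B).comap f :=
      Subgroup.comap_mono (show H ≤ fitting B from le_sSup ⟨hn, hH⟩) y.2
    have hxk : (x : A) ∈ f.ker := congrArg Subtype.val (MonoidHom.mem_ker.1 hx)
    exact Subtype.ext (Subgroup.mem_centralizer_iff.1
      (Subgroup.commutator_eq_bot_iff_le_centralizer.1 hk hxk) y hy)
  have hker : f.ker ≤ fitting A := hkey ⊥ inferInstance inferInstance
  -- Writing the right side as a preimage reduces the claim to one nilpotent normal subgroup of `B`
  -- at a time, avoiding the preimage of a join.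
  rw [← Subgroup.comap_map_eq_self hker]
  refine Subgroup.comap_mono (sSup_le fun H hH => ?_)
  rw [← Subgroup.map_comap_eq_self_of_surjective hf H]
  exact Subgroup.map_mono (hkey H hH.1 hH.2)

/-! ### Gaschütz's lemma -/

/-- The number of tuples lifting `t` along `f` and generating `H` is the same for all generating
tuples `t` of the target. -/
theorem card_generating_lifts_eq {A B ι : Type*} [Group A] [Finite A] [Group B] [Finite ι]
    (f : A →* B) {t t' : ι → B} (ht : Subgroup.closure (Set.range t) = ⊤)
    (ht' : Subgroup.closure (Set.range t') = ⊤) (H : Subgroup A) :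
    Nat.card {x : ι → A // f ∘ x = t ∧ Subgroup.closure (Set.range x) = H} =
      Nat.card {x : ι → A // f ∘ x = t' ∧ Subgroup.closure (Set.range x) = H} := by
  induction H using WellFoundedLT.induction with
  | ind H ih =>
  have hmap : ∀ {s : ι → B}, Subgroup.closure (Set.range s) = ⊤ → ∀ x : ι → A,
      f ∘ x = s ∧ Subgroup.closure (Set.range x) = H → H.map f = ⊤ := by
    rintro s hs x ⟨hx, rfl⟩
    rw [MonoidHom.map_closure, ← Set.range_comp, hx, hs]
  by_cases hH : H.map f = ⊤
  swap
  · have h : ∀ s : ι → B, Subgroup.closure (Set.range s) = ⊤ →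
        IsEmpty {x : ι → A // f ∘ x = s ∧ Subgroup.closure (Set.range x) = H} :=
      fun s hs => ⟨fun x => hH (hmap hs x.1 x.2)⟩
    have := h t ht
    have := h t' ht'
    rw [Nat.card_of_isEmpty, Nat.card_of_isEmpty]
  classical
  have := Fintype.ofFinite (Subgroup A)
  -- Lifts with entries in `H` are sorted by the subgroup they generate; induction handles the
  -- proper ones, so only the total has to be compared.
  let e : ∀ s : ι → B, {x : ι → A // f ∘ x = s ∧ Subgroup.closure (Set.range x) ≤ H} ≃
      Σ K : {K : Subgroup A // K ≤ H},
        {x : ι → A // f ∘ x = s ∧ Subgroup.closure (Set.range x) = K} := fun s =>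
    { toFun := fun x => ⟨⟨_, x.2.2⟩, x.1, x.2.1, rfl⟩
      invFun := fun y => ⟨y.2.1, y.2.2.1, y.2.2.2.trans_le y.1.2⟩
      left_inv := fun x => rfl
      right_inv := by
        rintro ⟨⟨K, hK⟩, ⟨x, hx⟩⟩
        obtain rfl : Subgroup.closure (Set.range x) = K := hx.2
        rfl }
  have hsum : ∀ s : ι → B,
      Nat.card {x : ι → A // f ∘ x = s ∧ Subgroup.closure (Set.range x) ≤ H} =
        Nat.card {x : ι → A // f ∘ x = s ∧ Subgroup.closure (Set.range x) = H} +
          ∑ K ∈ Finset.univ.erase (⟨H, le_rfl⟩ : {K : Subgroup A // K ≤ H}),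
            Nat.card {x : ι → A // f ∘ x = s ∧ Subgroup.closure (Set.range x) = K} := by
    intro s
    rw [Nat.card_congr (e s), Nat.card_sigma]
    exact (Finset.add_sum_erase _ (fun K : {K : Subgroup A // K ≤ H} =>
      Nat.card {x : ι → A // f ∘ x = s ∧ Subgroup.closure (Set.range x) = K})
      (Finset.mem_univ ⟨H, le_rfl⟩)).symm
  have htot : Nat.card {x : ι → A // f ∘ x = t ∧ Subgroup.closure (Set.range x) ≤ H} =
      Nat.card {x : ι → A // f ∘ x = t' ∧ Subgroup.closure (Set.range x) ≤ H} := by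
    -- As `f` maps `H` onto `B`, multiplication by a tuple in `H` turns lifts of `t` in `H` into
    -- lifts of `t'` in `H`.
    have hlift : ∀ i, ∃ a ∈ H, f a = t' i * (t i)⁻¹ := fun i =>
      Subgroup.mem_map.1 (hH ▸ Subgroup.mem_top _)
    choose a haH ha using hlift
    refine Nat.card_congr ((Equiv.mulLeft a).subtypeEquiv fun x => ?_)
    simp only [Subgroup.closure_le, Set.range_subset_iff, funext_iff, Function.comp_apply,
      Equiv.coe_mulLeft, Pi.mul_apply, map_mul, ha, SetLike.mem_coe]
    refine and_congr (forall_congr' fun i => ?_) (forall_congr' fun i => ?_)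
    · rw [mul_assoc, mul_eq_left, inv_mul_eq_one, eq_comm]
    · rw [H.mul_mem_cancel_left (haH i)]
  have hrest : ∑ K ∈ Finset.univ.erase (⟨H, le_rfl⟩ : {K : Subgroup A // K ≤ H}),
        Nat.card {x : ι → A // f ∘ x = t ∧ Subgroup.closure (Set.range x) = K} =
      ∑ K ∈ Finset.univ.erase (⟨H, le_rfl⟩ : {K : Subgroup A // K ≤ H}),
        Nat.card {x : ι → A // f ∘ x = t' ∧ Subgroup.closure (Set.range x) = K} :=
    Finset.sum_congr rfl fun K hK => ih K (lt_of_le_of_ne K.2 fun h =>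
      Finset.ne_of_mem_erase hK (Subtype.ext h))
  have h₁ := hsum t
  have h₂ := hsum t'
  omega

/-- **Gaschütz's lemma**: if `A` is generated by a tuple indexed by `ι`, then every generating
tuple indexed by `ι` of a quotient of `A` lifts to a generating tuple of `A`. -/
theorem exists_generating_lift {A B ι : Type*} [Group A] [Finite A] [Group B] [Finite ι]
    (f : A →* B) (hf : Function.Surjective f) {a : ι → A}
    (ha : Subgroup.closure (Set.range a) = ⊤) {t : ι → B}
    (ht : Subgroup.closure (Set.range t) = ⊤) :
    ∃ x : ι → A, f ∘ x = t ∧ Subgroup.closure (Set.range x) = ⊤ := by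
  have hfa : Subgroup.closure (Set.range (f ∘ a)) = ⊤ := by
    rw [Set.range_comp, ← MonoidHom.map_closure, ha, Subgroup.map_top_of_surjective f hf]
  have h := card_generating_lifts_eq f ht hfa ⊤
  have : Nonempty {x : ι → A // f ∘ x = f ∘ a ∧ Subgroup.closure (Set.range x) = ⊤} :=
    ⟨⟨a, rfl, ha⟩⟩
  have hpos := Nat.card_pos (α := {x : ι → A // f ∘ x = f ∘ a ∧ Subgroup.closure (Set.range x) = ⊤})
  rw [← h] at hpos
  obtain ⟨⟨x, hx⟩⟩ := (Nat.card_pos_iff.1 hpos).1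
  exact ⟨x, hx⟩

/-! ### The covering group and its multiplicator -/

section Covering

variable {G : Type*} [Group G] {n : ℕ}

theorem presentation_surjective {g : Fin n → G} (hg : Subgroup.closure (Set.range g) = ⊤) :
    Function.Surjective (presentation g) := by
  rw [← MonoidHom.range_eq_top, presentation, FreeGroup.range_lift_eq_closure, hg]

theorem coveringKernel_le_ker (g : Fin n → G) : coveringKernel g ≤ (presentation g).ker := by
  have := (fitting_normal G).comap (presentation g)
  refine sup_le (Subgroup.commutator_le_left _ _) ((Subgroup.closure_le _).2 ?_)
  rintro _ ⟨x, hx, rfl⟩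
  exact pow_mem hx _

/-- The natural projection `G* → G`. -/
noncomputable def coveringProj (g : Fin n → G) : CoveringGroup g →* G :=
  QuotientGroup.lift (coveringKernel g) (presentation g) (coveringKernel_le_ker g)

theorem coveringProj_mk (g : Fin n → G) (x : FreeGroup (Fin n)) :
    coveringProj g (QuotientGroup.mk' _ x) = presentation g x := rfl

theorem coveringProj_surjective {g : Fin n → G} (hg : Subgroup.closure (Set.range g) = ⊤) :
    Function.Surjective (coveringProj g) := fun y => by
  obtain ⟨x, rfl⟩ := presentation_surjective hg y
  exact ⟨QuotientGroup.mk' _ x, rfl⟩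

theorem ker_coveringProj (g : Fin n → G) : (coveringProj g).ker = multiplicator g := by
  ext y
  obtain ⟨x, rfl⟩ := QuotientGroup.mk'_surjective _ y
  rw [MonoidHom.mem_ker, coveringProj_mk]
  refine ⟨fun h => ⟨x, h, rfl⟩, ?_⟩
  rintro ⟨z, hz, hzx⟩
  rw [← coveringProj_mk, ← hzx]
  exact hz

theorem commutator_multiplicator_eq_bot (g : Fin n → G) :
    ⁅multiplicator g, (fitting G).comap (coveringProj g)⁆ = ⊥ := by
  have h : (fitting G).comap (coveringProj g) =
      ((fitting G).comap (presentation g)).map (QuotientGroup.mk' (coveringKernel g)) := by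
    rw [← Subgroup.map_comap_eq_self_of_surjective (QuotientGroup.mk'_surjective _)
      ((fitting G).comap (coveringProj g)), Subgroup.comap_comap]
    rfl
  rw [h, multiplicator, ← Subgroup.map_commutator, Subgroup.map_eq_bot_iff,
    QuotientGroup.ker_mk']
  exact le_sup_left

theorem pow_eq_one_of_mem_multiplicator {g : Fin n → G} {x : CoveringGroup g}
    (hx : x ∈ multiplicator g) : x ^ UniqueFactorizationMonoid.radical (fRank G) = 1 := by
  obtain ⟨y, hy, rfl⟩ := hx
  rw [← map_pow, ← MonoidHom.mem_ker, QuotientGroup.ker_mk']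
  exact (le_sup_right : _ ≤ coveringKernel g) (Subgroup.subset_closure ⟨y, hy, rfl⟩)

theorem multiplicator_le_comap_fitting (g : Fin n → G) :
    multiplicator g ≤ (fitting G).comap (coveringProj g) := by
  rw [← ker_coveringProj]
  exact MonoidHom.ker_le_comap _ _

/-- `R` has finite index in a finitely generated group, so `M` is finitely generated; it is also
abelian of finite exponent, hence finite, and `G*/M` embeds in `G`. -/
theorem finite_coveringGroup [Finite G] (g : Fin n → G) : Finite (CoveringGroup g) := by
  have hfi : (presentation g).ker.FiniteIndex := inferInstance
  have hfg : Group.FG (presentation g).ker := Subgroup.fg_of_index_ne_zero _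
  have hM : Group.FG (multiplicator g) :=
    Group.fg_of_surjective (MonoidHom.subgroupMap_surjective (QuotientGroup.mk' _) _)
  have hcomm : ∀ x y : multiplicator g, x * y = y * x := fun x y =>
    Subtype.ext (Subgroup.mem_centralizer_iff.1 (Subgroup.commutator_eq_bot_iff_le_centralizer.1
      (commutator_multiplicator_eq_bot g) y.2) x (multiplicator_le_comap_fitting g x.2))
  let _ : CommGroup (multiplicator g) := { (inferInstance : Group _) with mul_comm := hcomm }
  have hfin : Finite (multiplicator g) := CommGroup.finite_of_fg_isMulTorsion _ fun x =>
    isOfFinOrder_iff_pow_eq_one.2 ⟨_, Nat.pos_of_ne_zero UniqueFactorizationMonoid.radical_ne_zero,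
      Subtype.ext (pow_eq_one_of_mem_multiplicator x.2)⟩
  have : Finite (coveringProj g).ker := by rwa [ker_coveringProj]
  have : Finite (CoveringGroup g ⧸ (coveringProj g).ker) :=
    Finite.of_equiv _ (QuotientGroup.quotientKerEquivRange (coveringProj g)).symm.toEquiv
  exact Finite.of_subgroup_quotient (coveringProj g).ker

theorem closure_range_coveringGenerators (g : Fin n → G) :
    Subgroup.closure (Set.range fun i => QuotientGroup.mk' (coveringKernel g) (FreeGroup.of i)) =
      ⊤ := by
  have h : (Set.range fun i => QuotientGroup.mk' (coveringKernel g) (FreeGroup.of i)) =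
      QuotientGroup.mk' (coveringKernel g) '' Set.range FreeGroup.of := Set.range_comp _ _
  rw [h, ← MonoidHom.map_closure, FreeGroup.closure_range_of,
    Subgroup.map_top_of_surjective _ (QuotientGroup.mk'_surjective _)]

/-! ### Fitting subgroups and nuclei in quotients of `G*` -/

theorem comap_coveringProj_fitting_le {g : Fin n → G}
    (hg : Subgroup.closure (Set.range g) = ⊤) :
    (fitting G).comap (coveringProj g) ≤ fitting (CoveringGroup g) := by
  refine comap_fitting_le_of_commutator_eq_bot _ (coveringProj_surjective hg) ?_
  rw [ker_coveringProj]
  exact commutator_multiplicator_eq_bot g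

/-- The projection `G*/U → G` for a normal subgroup `U` of `G*` contained in the multiplicator. -/
noncomputable def quotientProj {g : Fin n → G} {U : Subgroup (CoveringGroup g)} [U.Normal]
    (hU : U ≤ multiplicator g) : CoveringGroup g ⧸ U →* G :=
  QuotientGroup.lift U (coveringProj g) (hU.trans (ker_coveringProj g).ge)

theorem quotientProj_surjective {g : Fin n → G} (hg : Subgroup.closure (Set.range g) = ⊤)
    {U : Subgroup (CoveringGroup g)} [U.Normal] (hU : U ≤ multiplicator g) :
    Function.Surjective (quotientProj hU) := fun y => by
  obtain ⟨x, rfl⟩ := coveringProj_surjective hg y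
  exact ⟨QuotientGroup.mk' U x, rfl⟩

/-- The preimage in `G*` of the Fitting subgroup of `G*/U` lies over `F(G)`, so it centralizes `M`
and in particular `U`. -/
theorem map_mk_fitting {g : Fin n → G} (hg : Subgroup.closure (Set.range g) = ⊤)
    {U : Subgroup (CoveringGroup g)} [U.Normal] (hU : U ≤ multiplicator g) :
    (fitting (CoveringGroup g)).map (QuotientGroup.mk' U) = fitting (CoveringGroup g ⧸ U) := by
  have hs := QuotientGroup.mk'_surjective U
  refine le_antisymm (map_fitting_le _ hs) ?_
  rw [← Subgroup.map_comap_eq_self_of_surjective hs (fitting (CoveringGroup g ⧸ U))]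
  refine Subgroup.map_mono (comap_fitting_le_of_commutator_eq_bot _ hs ?_)
  rw [QuotientGroup.ker_mk', eq_bot_iff, ← commutator_multiplicator_eq_bot g]
  refine Subgroup.commutator_mono hU ?_
  have h := Subgroup.map_le_iff_le_comap.1 (map_fitting_le _ (quotientProj_surjective hg hU))
  exact Subgroup.comap_mono (f := QuotientGroup.mk' U) h

/-- This describes `M/U` intrinsically in `G*/U`: since `NU = M`, it is the image of the nucleus. -/
theorem IsAllowable.map_mk_multiplicator [Finite G] {g : Fin n → G}
    (hg : Subgroup.closure (Set.range g) = ⊤) {U : Subgroup (CoveringGroup g)} [U.Normal]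
    (h : IsAllowable g U) :
    (multiplicator g).map (QuotientGroup.mk' U) = nu (CoveringGroup g ⧸ U) (fClass G) := by
  have := finite_coveringGroup g
  rw [← map_nu _ (map_mk_fitting hg h.lt_multiplicator.le), ← h.nucleus_sup, Subgroup.map_sup,
    QuotientGroup.map_mk'_self, sup_bot_eq]
  rfl

/-! ### Lifting isomorphisms to `G*` -/

/-- An isomorphism between quotients of `G*` by allowable subgroups lifts to a surjective
endomorphism of `G*` preserving the multiplicator. -/
theorem exists_lift_of_quotient_mulEquiv [Finite G] {g : Fin n → G}
    (hg : Subgroup.closure (Set.range g) = ⊤) {U₁ U₂ : Subgroup (CoveringGroup g)}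
    [U₁.Normal] [U₂.Normal] (h₁ : IsAllowable g U₁) (h₂ : IsAllowable g U₂)
    (ψ : CoveringGroup g ⧸ U₁ ≃* CoveringGroup g ⧸ U₂) :
    ∃ α : CoveringGroup g →* CoveringGroup g, Function.Surjective α ∧
      (∀ y, QuotientGroup.mk' U₂ (α y) = ψ (QuotientGroup.mk' U₁ y)) ∧
      (multiplicator g).map α ≤ multiplicator g := by
  have := finite_coveringGroup g
  let π := QuotientGroup.mk' (coveringKernel g)
  let π₁ := QuotientGroup.mk' U₁
  let π₂ := QuotientGroup.mk' U₂
  let β : CoveringGroup g →* CoveringGroup g ⧸ U₂ := ψ.toMonoidHom.comp π₁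
  have hβ : Function.Surjective β := ψ.surjective.comp (QuotientGroup.mk'_surjective U₁)
  have hgen := closure_range_coveringGenerators g
  have ht : Subgroup.closure (Set.range (β ∘ fun i => π (FreeGroup.of i))) = ⊤ := by
    rw [Set.range_comp, ← MonoidHom.map_closure, hgen, Subgroup.map_top_of_surjective _ hβ]
  obtain ⟨x, hxβ, hx⟩ := exists_generating_lift π₂ (QuotientGroup.mk'_surjective U₂) hgen ht
  let θ : FreeGroup (Fin n) →* CoveringGroup g := FreeGroup.lift x
  have hθs : Function.Surjective θ := by
    rw [← MonoidHom.range_eq_top, FreeGroup.range_lift_eq_closure, hx]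
  have hθ : π₂.comp θ = β.comp π := by
    ext i
    simpa [θ] using congrFun hxβ i
  have hβM : (multiplicator g).map β = (multiplicator g).map π₂ := by
    have hfit : (fitting (CoveringGroup g ⧸ U₁)).map ψ.toMonoidHom =
        fitting (CoveringGroup g ⧸ U₂) := by
      refine le_antisymm (map_fitting_le _ ψ.surjective) fun y hy => ?_
      exact ⟨ψ.symm y, map_fitting_le ψ.symm.toMonoidHom ψ.symm.surjective ⟨y, hy, rfl⟩,
        ψ.apply_symm_apply y⟩
    rw [← Subgroup.map_map, h₁.map_mk_multiplicator hg, map_nu _ hfit,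
      h₂.map_mk_multiplicator hg]
  -- Modulo `U₂`, the image of `R` under `θ` is `β(M) = M/U₂`; as `U₂ ≤ M`, it already lies in `M`.
  have hθR : (presentation g).ker.map θ ≤ multiplicator g := by
    have hle : ((presentation g).ker.map θ).map π₂ ≤ (multiplicator g).map π₂ := by
      rw [Subgroup.map_map, hθ, ← Subgroup.map_map, ← hβM]
      rfl
    rwa [Subgroup.map_le_iff_le_comap, Subgroup.comap_map_eq_self] at hle
    rw [QuotientGroup.ker_mk']
    exact h₂.lt_multiplicator.le
  have hθL : ((fitting G).comap (presentation g)).map θ ≤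
      (fitting G).comap (coveringProj g) := by
    rw [Subgroup.map_le_iff_le_comap]
    intro y hy
    -- Epimorphisms send Fitting subgroups into Fitting subgroups; this is applied to `β` and then
    -- to `G*/U₂ → G`.
    have hy' : π y ∈ fitting (CoveringGroup g) := comap_coveringProj_fitting_le hg hy
    have hβy := map_fitting_le β hβ ⟨_, hy', rfl⟩
    have hβy' := map_fitting_le _ (quotientProj_surjective hg h₂.lt_multiplicator.le)
      ⟨_, hβy, rfl⟩
    have heq : π₂ (θ y) = β (π y) := DFunLike.congr_fun hθ y
    rw [← heq] at hβy'
    exact hβy'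
  -- The relations defining `K` hold in `G*`: `M` commutes with the preimage of `F(G)` and has
  -- exponent dividing `k`.
  have hθK : coveringKernel g ≤ θ.ker := by
    refine sup_le ?_ ((Subgroup.closure_le _).2 ?_)
    · rw [← Subgroup.map_eq_bot_iff, Subgroup.map_commutator, eq_bot_iff,
        ← commutator_multiplicator_eq_bot g]
      exact Subgroup.commutator_mono hθR hθL
    · rintro _ ⟨y, hy, rfl⟩
      change θ (y ^ _) = 1
      rw [map_pow]
      exact pow_eq_one_of_mem_multiplicator (hθR ⟨y, hy, rfl⟩)
  refine ⟨QuotientGroup.lift (coveringKernel g) θ hθK, fun y => ?_, fun y => ?_, ?_⟩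
  · obtain ⟨z, rfl⟩ := hθs y
    exact ⟨π z, rfl⟩
  · obtain ⟨z, rfl⟩ := QuotientGroup.mk'_surjective _ y
    exact DFunLike.congr_fun hθ z
  · rintro _ ⟨_, ⟨z, hz, rfl⟩, rfl⟩
    exact hθR ⟨z, hz, rfl⟩

end Covering

end FCentral

/-! ### The isomorphism criterion -/

theorem mainTheorem1 {G : Type*} [Group G] [Finite G] {n : ℕ} (g : Fin n → G)
    (hg : Subgroup.closure (Set.range g) = ⊤)
    (U₁ U₂ : Subgroup (FCentral.CoveringGroup g)) [U₁.Normal] [U₂.Normal]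
    (h₁ : FCentral.IsAllowable g U₁) (h₂ : FCentral.IsAllowable g U₂) :
    Nonempty (FCentral.CoveringGroup g ⧸ U₁ ≃* FCentral.CoveringGroup g ⧸ U₂) ↔
      ∃ α ∈ FCentral.autM g, U₁.map α.toMonoidHom = U₂ := by
  constructor
  · rintro ⟨ψ⟩
    have := FCentral.finite_coveringGroup g
    obtain ⟨α, hs, hα, hM⟩ := FCentral.exists_lift_of_quotient_mulEquiv hg h₁ h₂ ψ
    have hb : Function.Bijective α := Finite.surjective_iff_bijective.1 hs
    refine ⟨MulEquiv.ofBijective α hb, ?_, ?_⟩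
    · exact Subgroup.eq_of_le_of_card_ge hM (Subgroup.card_map_of_injective hb.1).ge
    · ext y
      obtain ⟨x, rfl⟩ := hs y
      -- `α` induces the injective map `ψ` on the quotients, so `U₁` is exactly the preimage of
      -- `U₂`.
      have hmem : α x ∈ U₂ ↔ x ∈ U₁ := by
        rw [← QuotientGroup.eq_one_iff (N := U₂), ← QuotientGroup.eq_one_iff (N := U₁)]
        rw [← map_eq_one_iff ψ ψ.injective]
        exact Eq.congr_left (hα x)
      rw [hmem]
      exact Subgroup.mem_map_iff_mem hb.1
  · rintro ⟨α, -, hα⟩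
    exact ⟨QuotientGroup.congr U₁ U₂ α hα⟩
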